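/- Let $n$ be a positive odd squarefree integer and let $i\in\mathbb{Z}$. Let $\left(\frac{\cdot}{n}\right)$ denote the Jacobi symbol. An integer $a$ is called a quadratic residue modulo $n$ if $\gcd(a,n)=1$ and $x^2\equiv a\pmod n$ for some $x\in\mathbb{Z}$. Then $$\sum_{j=0}^{n-1}\left(\frac{j}{n}\right)\left(\frac{i^2+cij+dj^2}{n}\right)=0$$ in each of the following cases: 1. $(c,d)=(3,2)$ and $-1$ is not a quadratic residue modulo $n$; 2. $(c,d)=(4,2)$ and $-2$ is not a quadratic residue modulo $n$; 3. $(c,d)=(3,3)$ and $-3$ is not a quadratic residue modulo $n$; 4. $(c,d)=(21,112)$ and $-7$ is not a quadratic residue modulo $n$. -/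

import Mathlib

/-- `a` is a quadratic residue modulo `n`: `a` is relatively prime to `n` and is congruent
to a square modulo `n`. -/
def IsQuadraticResidue (a : ℤ) (n : ℕ) : Prop :=
  IsCoprime a (n : ℤ) ∧ ∃ x : ℤ, x ^ 2 ≡ a [ZMOD (n : ℤ)]

/-! If `a` is not a residue mod the squarefree `n`, some prime `p ∣ n` has `quadraticChar a ≠ 1` (0
is possible: `p = 3` or `7`). Writing `n = p * m`, the Jacobi symbol splits and the sum over each
class mod `m` is a multiple of a full sum over `ZMod p`, so one such prime suffices. By homogeneity
that sum is, up to a factor, `cubicCharSum c d`, the trace of the curve `y² = x³ + cx² + dx`. The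
curves have complex multiplication by orders in ℚ(√-1), ℚ(√-2), ℚ(√-3), ℚ(√-7). The first three
traces vanish by elementary symmetries. For -7 a degree-two endomorphism forces the Hasse invariant
to vanish, so `p` divides a sum of absolute value below `p`. -/

/-- The character sum of the cubic `x ^ 3 + a * x ^ 2 + b * x` over a finite field. -/
def cubicCharSum {F : Type*} [Field F] [Fintype F] [DecidableEq F] (a b : F) : ℤ :=
  ∑ x : F, quadraticChar F (x ^ 3 + a * x ^ 2 + b * x)

/-! ### Cubic character sums over a finite field. -/

section FiniteField

variable {F : Type*} [Field F] [Fintype F] [DecidableEq F]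

theorem quadraticChar_mul_sq {x : F} (hx : x ≠ 0) (y : F) :
    quadraticChar F (x ^ 2 * y) = quadraticChar F y := by
  rw [map_mul, quadraticChar_sq_one' hx, one_mul]

theorem sum_ite_quadratic_eq (hF : ringChar F ≠ 2) (u b : F) :
    (∑ x : F, if x ^ 2 - u * x + b = 0 then (1 : ℤ) else 0) =
      quadraticChar F (u ^ 2 - 4 * b) + 1 := by
  have h2 : (2 : F) ≠ 0 := Ring.two_ne_zero hF
  rw [← quadraticChar_card_sqrts hF, Finset.sum_boole, Nat.cast_inj]
  refine Finset.card_bij (fun x _ => 2 * x - u) ?_ ?_ ?_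
  · intro x hx
    simp only [Finset.mem_filter, Finset.mem_univ, true_and, Set.mem_toFinset,
      Set.mem_ofPred_eq] at hx ⊢
    linear_combination 4 * hx
  · intro x _ y _ hxy
    have : 2 * x = 2 * y := by linear_combination hxy
    exact mul_left_cancel₀ h2 this
  · intro y hy
    simp only [Set.mem_toFinset, Set.mem_ofPred_eq] at hy
    refine ⟨(y + u) / 2, ?_, by field_simp; ring⟩
    simp only [Finset.mem_filter, Finset.mem_univ, true_and]
    field_simp
    linear_combination hy

/-- Invariance of the character sum under the `2`-isogeny with kernel generated by the origin. -/
theorem cubicCharSum_two_isogeny (hF : ringChar F ≠ 2) (a : F) {b : F} (hb : b ≠ 0) :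
    cubicCharSum a b = cubicCharSum (-2 * a) (a ^ 2 - 4 * b) := by
  have hsum : ∑ u : F, quadraticChar F (u + a) = 0 :=
    (Fintype.sum_equiv (Equiv.addRight a) _ _ fun _ => rfl).trans (quadraticChar_sum_zero hF)
  calc cubicCharSum a b
      -- For `x ≠ 0` the cubic is `x² (u + a)` with `u = x + b / x`; sum over the fibres of `x ↦ u`.
      = ∑ x : F, ∑ u : F, quadraticChar F (u + a) * if x ^ 2 - u * x + b = 0 then 1 else 0 := by
        refine Finset.sum_congr rfl fun x _ => ?_
        rcases eq_or_ne x 0 with rfl | hx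
        · simp [hb]
        · rw [Finset.sum_eq_single ((x ^ 2 + b) / x)]
          · rw [if_pos (by field_simp; ring), mul_one, ← quadraticChar_mul_sq hx (_ + a)]
            congr 1
            field_simp
            ring
          · intro u _ hu
            rw [if_neg, mul_zero]
            intro h
            apply hu
            rw [eq_div_iff hx]
            linear_combination -h
          · simp
    _ = ∑ u : F, quadraticChar F (u + a) * (quadraticChar F (u ^ 2 - 4 * b) + 1) := by
        rw [Finset.sum_comm]
        refine Finset.sum_congr rfl fun u _ => ?_
        rw [← Finset.mul_sum, sum_ite_quadratic_eq hF]
    _ = ∑ u : F, quadraticChar F ((u + a) * (u ^ 2 - 4 * b)) := by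
        simp_rw [mul_add, mul_one, Finset.sum_add_distrib, hsum, add_zero, map_mul]
    _ = cubicCharSum (-2 * a) (a ^ 2 - 4 * b) := by
        refine Fintype.sum_equiv (Equiv.addRight a) _ _ fun u => ?_
        simp only [Equiv.coe_addRight]
        congr 1
        ring

/-- The cubic `x (x + 1) (x + 2)` is odd about its middle root `-1`. -/
theorem cubicCharSum_three_two (h : quadraticChar F (-1) = -1) :
    cubicCharSum (3 : F) 2 = 0 := by
  have h1 : cubicCharSum (3 : F) 2 = -cubicCharSum (3 : F) 2 := by
    unfold cubicCharSum
    rw [← Finset.sum_neg_distrib]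
    refine Fintype.sum_equiv (Equiv.subLeft (-2)) _ _ fun x => ?_
    rw [Equiv.subLeft_apply, ← neg_one_mul, ← h, ← map_mul]
    congr 1
    ring
  linarith

/-- The 2-isogenous cubic has coefficients `(-8, 8)`, which is the twist of `(4, 2)` by `-2`. -/
theorem cubicCharSum_four_two (hF : ringChar F ≠ 2) (h : quadraticChar F (-2) = -1) :
    cubicCharSum (4 : F) 2 = 0 := by
  have h2 : (2 : F) ≠ 0 := Ring.two_ne_zero hF
  have h1 : cubicCharSum (4 : F) 2 = -cubicCharSum (4 : F) 2 := by
    conv_lhs => rw [cubicCharSum_two_isogeny hF _ h2]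
    unfold cubicCharSum
    rw [← Finset.sum_neg_distrib]
    symm
    refine Fintype.sum_equiv (Equiv.mulLeft₀ (-2) (neg_ne_zero.mpr h2)) _ _ fun x => ?_
    rw [Equiv.mulLeft₀_apply, ← neg_one_mul, ← h, ← map_mul, ← quadraticChar_mul_sq h2]
    congr 1
    ring
  linarith

/-- Two distinct elements with equal cubes have ratio `ω` with `(2ω + 1)² = -3`. -/
theorem pow_three_injective (h : quadraticChar F (-3) ≠ 1) :
    Function.Injective fun x : F => x ^ 3 := by
  intro x y hxy
  by_contra hne
  have h1 : (2 * x + y) ^ 2 = -3 * y ^ 2 := by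
    have : (x - y) * (x ^ 2 + x * y + y ^ 2) = 0 := by linear_combination hxy
    have := (mul_eq_zero.mp this).resolve_left (sub_ne_zero.mpr hne)
    linear_combination 4 * this
  have hy : y ≠ 0 := by
    rintro rfl
    exact hne (by simpa using hxy)
  have h3 : (-3 : F) ≠ 0 := by
    intro h3
    rw [h3, zero_mul, sq_eq_zero_iff] at h1
    exact hne (by linear_combination -x * h3 - h1)
  refine h ((quadraticChar_one_iff_isSquare h3).mpr ⟨(2 * x + y) / y, ?_⟩)
  field_simp
  linear_combination -h1

/-- The cubic is `(x + 1)³ - 1`, a permutation of the field. -/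
theorem cubicCharSum_three_three (hF : ringChar F ≠ 2) (h : quadraticChar F (-3) ≠ 1) :
    cubicCharSum (3 : F) 3 = 0 := by
  rw [← quadraticChar_sum_zero hF, cubicCharSum]
  have hb : Function.Bijective fun x : F => (x + 1) ^ 3 - 1 := by
    refine Finite.injective_iff_bijective.mp fun x y hxy => ?_
    exact add_right_cancel (pow_three_injective h (sub_left_injective hxy))
  refine Fintype.sum_bijective _ hb _ _ fun x => ?_
  congr 1
  ring

theorem abs_cubicCharSum_lt (a b : F) : |cubicCharSum a b| < Fintype.card F := by
  unfold cubicCharSum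
  rw [← Finset.add_sum_erase _ _ (Finset.mem_univ 0)]
  have h0 : quadraticChar F (0 ^ 3 + a * 0 ^ 2 + b * 0) = 0 := by simp
  rw [h0, zero_add]
  refine (Finset.abs_sum_le_sum_abs _ _).trans_lt ?_
  refine (Finset.sum_le_card_nsmul _ _ 1 fun x _ => ?_).trans_lt ?_
  · rcases quadraticChar_isQuadratic F (x ^ 3 + a * x ^ 2 + b * x) with h | h | h <;> simp [h]
  · have := Fintype.card_pos (α := F)
    simpa [Finset.card_erase_of_mem] using this

end FiniteField

/-! ### The Hasse invariant as a polynomial coefficient. -/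

section MidCoeff

open Polynomial

/-- The coefficient of `X ^ m` in `(X ^ 2 + a * X + b) ^ m`; if `2 * m + 1` is the characteristic,
this is the Hasse invariant of `y ^ 2 = x ^ 3 + a * x ^ 2 + b * x`. -/
noncomputable def midCoeff {R : Type*} [CommRing R] (m : ℕ) (a b : R) : R :=
  ((X ^ 2 + C a * X + C b) ^ m).coeff m

theorem map_midCoeff {R S : Type*} [CommRing R] [CommRing S] (f : R →+* S) (m : ℕ) (a b : R) :
    f (midCoeff m a b) = midCoeff m (f a) (f b) := by
  simp only [midCoeff, ← coeff_map, Polynomial.map_pow, Polynomial.map_add, Polynomial.map_mul,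
    map_X, map_C]

theorem natDegree_coeff_pow_le {R : Type*} [CommRing R] {P : R[X][X]} {d : ℕ}
    (h : ∀ k, (P.coeff k).natDegree ≤ d) (m k : ℕ) : ((P ^ m).coeff k).natDegree ≤ d * m := by
  induction m generalizing k with
  | zero => rw [pow_zero, coeff_one]; split_ifs <;> simp
  | succ m ih =>
    rw [pow_succ, coeff_mul]
    refine natDegree_sum_le_of_forall_le _ _ fun i _ => ?_
    exact natDegree_mul_le.trans ((Nat.add_le_add (ih _) (h _)).trans_eq (by ring))

/-- With polynomial entries, this bound lets identities in `a` or `b` be checked at enough points.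
-/
theorem natDegree_midCoeff_le {R : Type*} [CommRing R] {m d : ℕ} {a b : R[X]}
    (ha : a.natDegree ≤ d) (hb : b.natDegree ≤ d) : (midCoeff m a b).natDegree ≤ d * m := by
  refine natDegree_coeff_pow_le (fun k => ?_) m m
  simp only [coeff_add, coeff_X_pow, coeff_C_mul, coeff_X, coeff_C]
  refine (natDegree_add_le_of_degree_le (natDegree_add_le_of_degree_le (n := d) ?_ ?_) ?_)
  · split_ifs <;> simp
  · split_ifs <;> simp [ha]
  · split_ifs <;> simp [hb]

theorem eval_midCoeff {R : Type*} [CommRing R] (m : ℕ) (a b : R[X]) (x : R) :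
    (midCoeff m a b).eval x = midCoeff m (a.eval x) (b.eval x) :=
  map_midCoeff (evalRingHom x) m a b

theorem midCoeff_eq_coeff_cubic_pow {R : Type*} [CommRing R] (m : ℕ) (a b : R) :
    midCoeff m a b = ((X ^ 3 + C a * X ^ 2 + C b * X) ^ m).coeff (2 * m) := by
  have : (X ^ 3 + C a * X ^ 2 + C b * X : R[X]) = (X ^ 2 + C a * X + C b) * X := by ring
  rw [this, mul_pow, two_mul, coeff_mul_X_pow, midCoeff]

theorem natDegree_cubic_pow_le {R : Type*} [CommRing R] (m : ℕ) (a b : R) :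
    ((X ^ 3 + C a * X ^ 2 + C b * X) ^ m).natDegree ≤ 3 * m := by
  have h : (X ^ 3 + C a * X ^ 2 + C b * X : R[X]).natDegree ≤ 3 := by compute_degree
  exact natDegree_pow_le.trans ((Nat.mul_le_mul_left _ h).trans_eq (by ring))

end MidCoeff

/-! ### Hasse invariants in characteristic `p` and the case of `√-7`. -/

section Hasse

open Polynomial

theorem FiniteField.sum_pow_eq_ite {F : Type*} [Field F] [Fintype F] [DecidableEq F] {i : ℕ}
    (hi : i < 2 * (Fintype.card F - 1)) :
    ∑ x : F, x ^ i = if i = Fintype.card F - 1 then -1 else 0 := by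
  rcases eq_or_ne i 0 with rfl | h0
  · have := Fintype.one_lt_card (α := F)
    rw [if_neg (by omega)]
    simp
  · have h : ∑ x : F, x ^ i = ∑ x : Fˣ, (x ^ i : F) := by
      rw [← Finset.add_sum_erase _ _ (Finset.mem_univ (0 : F)), zero_pow h0, zero_add]
      symm
      refine Finset.sum_bij (fun x _ => (x : F)) (by simp) (fun _ _ _ _ h => Units.ext h) ?_
        (by simp)
      intro x hx
      exact ⟨Units.mk0 x (Finset.ne_of_mem_erase hx), Finset.mem_univ _, rfl⟩
    rw [h, FiniteField.sum_pow_units]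
    refine if_congr ⟨?_, fun h => h ▸ dvd_rfl⟩ rfl rfl
    rintro ⟨k, rfl⟩
    have : k < 2 := by nlinarith
    interval_cases k
    · simp at h0
    · simp

theorem FiniteField.sum_eval_eq_neg_coeff {F : Type*} [Field F] [Fintype F] [DecidableEq F]
    {P : F[X]} (hP : P.natDegree < 2 * (Fintype.card F - 1)) :
    ∑ x : F, P.eval x = -P.coeff (Fintype.card F - 1) := by
  simp_rw [eval_eq_sum_range' hP]
  rw [Finset.sum_comm]
  simp_rw [← Finset.mul_sum]
  rw [Finset.sum_congr rfl fun i hi =>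
    congrArg _ (FiniteField.sum_pow_eq_ite (Finset.mem_range.mp hi))]
  have := Fintype.one_lt_card (α := F)
  simp only [mul_ite, mul_zero, Finset.sum_ite_eq', Finset.mem_range]
  rw [if_pos (by omega), mul_neg_one]

variable {p : ℕ} [hp : Fact p.Prime]

/-- Euler's criterion turns the character into an `m`-th power; as `3m < 2(p - 1)`, only the
coefficient of `X ^ (p - 1)` survives summation. -/
theorem cubicCharSum_cast {m : ℕ} (hm : p = 2 * m + 1) (a b : ZMod p) :
    (cubicCharSum a b : ZMod p) = -midCoeff m a b := by
  have hF : ringChar (ZMod p) ≠ 2 := by rw [ZMod.ringChar_zmod_n]; omega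
  have hc : Fintype.card (ZMod p) - 1 = 2 * m := by rw [ZMod.card]; omega
  have hm0 : 0 < m := by have := hp.out.two_le; omega
  have hdeg := natDegree_cubic_pow_le m a b
  rw [midCoeff_eq_coeff_cubic_pow, ← hc, ← FiniteField.sum_eval_eq_neg_coeff (by omega),
    cubicCharSum, Int.cast_sum]
  refine Finset.sum_congr rfl fun x _ => ?_
  rw [quadraticChar_eq_pow_of_char_ne_two' hF, ZMod.card, show p / 2 = m by omega]
  simp

theorem midCoeff_two_isogeny_prime_field {m : ℕ} (hm : p = 2 * m + 1) (a : ZMod p) {b : ZMod p}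
    (hb : b ≠ 0) : midCoeff m a b = midCoeff m (-2 * a) (a ^ 2 - 4 * b) := by
  have hF : ringChar (ZMod p) ≠ 2 := by rw [ZMod.ringChar_zmod_n]; omega
  rw [← neg_inj, ← cubicCharSum_cast hm, ← cubicCharSum_cast hm, cubicCharSum_two_isogeny hF a hb]

variable {K : Type*} [Field K] [Algebra (ZMod p) K]

theorem midCoeff_two_isogeny {m : ℕ} (hm : p = 2 * m + 1) (a b : K) :
    midCoeff m a b = midCoeff m (-2 * a) (a ^ 2 - 4 * b) := by
  classical
  have hm0 : 0 < m := by have := hp.out.two_le; omega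
  have hinj := (algebraMap (ZMod p) K).injective
  -- For `b` in the prime field, both sides have degree at most `2m < p` in `a` and agree at all `p`
  -- points.
  have ha : ∀ (a : K) {b : ZMod p}, b ≠ 0 → midCoeff m a (algebraMap _ K b) =
      midCoeff m (-2 * a) (a ^ 2 - 4 * algebraMap _ K b) := by
    intro a b hb
    have h : midCoeff m (X : K[X]) (C (algebraMap _ K b)) -
        midCoeff m (-2 * X) (X ^ 2 - 4 * C (algebraMap _ K b)) = 0 := by
      refine eq_zero_of_natDegree_lt_card_of_eval_eq_zero _ hinj (fun x => ?_) ?_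
      · have := congrArg (algebraMap (ZMod p) K) (midCoeff_two_isogeny_prime_field hm x hb)
        rw [map_midCoeff, map_midCoeff] at this
        simpa [eval_midCoeff, sub_eq_zero, map_ofNat (algebraMap (ZMod p) K)] using this
      · rw [ZMod.card]
        have h1 := natDegree_midCoeff_le (m := m) (d := 2) (a := (X : K[X]))
          (b := C (algebraMap _ K b)) (by compute_degree!) (by compute_degree!)
        have h2 := natDegree_midCoeff_le (m := m) (d := 2) (a := (-2 * X : K[X]))
          (b := X ^ 2 - 4 * C (algebraMap _ K b)) (by compute_degree!) (by compute_degree!)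
        have := natDegree_sub_le_of_le h1 h2
        rw [max_self] at this
        omega
    have := congrArg (eval a) h
    simpa [eval_midCoeff, sub_eq_zero] using this
  -- Now `a` is fixed: degree at most `m` in `b`, below the `p - 1 = 2m` nonzero points.
  have h : midCoeff m (C a) X - midCoeff m (-2 * C a) (C a ^ 2 - 4 * X) = 0 := by
    refine eq_zero_of_natDegree_lt_card_of_eval_eq_zero (ι := {x : ZMod p // x ≠ 0}) _
      (hinj.comp Subtype.val_injective) (fun x => ?_) ?_
    · simpa [eval_midCoeff, sub_eq_zero] using ha a x.2
    · have hcard : Fintype.card {x : ZMod p // x ≠ 0} = p - 1 := by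
        simp [Fintype.card_subtype_compl, ZMod.card]
      have h1 := natDegree_midCoeff_le (m := m) (d := 1) (a := C a)
        (b := X) (by compute_degree!) (by compute_degree!)
      have h2 := natDegree_midCoeff_le (m := m) (d := 1) (a := -2 * C a)
        (b := C a ^ 2 - 4 * X) (by compute_degree!) (by compute_degree!)
      have := natDegree_sub_le_of_le h1 h2
      rw [max_self] at this
      rw [hcard]
      omega
  have := congrArg (eval b) h
  simpa [eval_midCoeff, sub_eq_zero] using this

/-- In characteristic `p` the coefficient of `X ^ (p - 1)` is invariant under translation. -/
theorem coeff_taylor_prime_sub_one {P : K[X]} (hP : P.natDegree < 2 * p - 1) (r : K) :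
    (taylor r P).coeff (p - 1) = P.coeff (p - 1) := by
  have : CharP K p := charP_of_injective_algebraMap (algebraMap (ZMod p) K).injective p
  have hp1 := hp.out.one_lt
  have : hasseDeriv (p - 1) P = C (P.coeff (p - 1)) := by
    ext k
    rw [hasseDeriv_coeff, coeff_C]
    split_ifs with hk
    · simp [hk]
    · rcases lt_or_ge k p with hkp | hkp
      · have hdvd : p ∣ (k + (p - 1)).choose (p - 1) := by
          refine hp.out.dvd_choose (by omega) (by omega) (by omega)
        rw [(CharP.cast_eq_zero_iff K p _).mpr hdvd, zero_mul]
      · rw [coeff_eq_zero_of_natDegree_lt (by omega), mul_zero]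
  rw [taylor_coeff, this, eval_C]

/-- Translating the cubic by a root `r` of its quadratic factor. -/
theorem midCoeff_translate {m : ℕ} (hm : p = 2 * m + 1) {a b r : K}
    (hr : r ^ 2 + a * r + b = 0) :
    midCoeff m a b = midCoeff m (3 * r + a) (3 * r ^ 2 + 2 * a * r + b) := by
  have hm0 : 0 < m := by have := hp.out.two_le; omega
  have hdeg := natDegree_cubic_pow_le m a b
  rw [midCoeff_eq_coeff_cubic_pow, midCoeff_eq_coeff_cubic_pow, show 2 * m = p - 1 by omega,
    ← coeff_taylor_prime_sub_one (by omega) r]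
  congr 1
  rw [taylor_apply, pow_comp]
  congr 1
  have hr' : (C r ^ 2 + C a * C r + C b : K[X]) = 0 := by
    rw [← C_pow, ← C_mul, ← C_add, ← C_add, hr, C_0]
  simp only [add_comp, mul_comp, pow_comp, X_comp, C_comp, C_add, C_mul, C_pow, C_ofNat]
  linear_combination C r * hr'

theorem midCoeff_scale (m : ℕ) {l : K} (hl : l ≠ 0) (a b : K) :
    midCoeff m (l * a) (l ^ 2 * b) = l ^ m * midCoeff m a b := by
  have h : ((X ^ 2 + C (l * a) * X + C (l ^ 2 * b)) ^ m).comp (C l * X) =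
      C (l ^ (2 * m)) * (X ^ 2 + C a * X + C b) ^ m := by
    rw [pow_mul, C_pow (n := m), ← mul_pow, pow_comp]
    congr 1
    simp only [add_comp, mul_comp, pow_comp, X_comp, C_comp, C_mul, C_pow]
    ring
  have := congrArg (fun P => P.coeff m) h
  simp only [comp_C_mul_X_coeff, coeff_C_mul] at this
  rw [midCoeff, midCoeff]
  refine mul_right_cancel₀ (pow_ne_zero m hl) (this.trans ?_)
  ring

/-- Over a field containing a root `r` of `X ^ 2 + 21 * X + 112`, the elliptic curve
`y ^ 2 = x ^ 3 + 21 * x ^ 2 + 112 * x` has an endomorphism of degree two multiplying the invariant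
differential by `r + 11 = (1 ± √-7) / 2`. Its Hasse invariant therefore vanishes when the
Frobenius map exchanges `r` with the other root. -/
theorem midCoeff_twenty_one_eq_zero {m : ℕ} (hm : p = 2 * m + 1) {r : K}
    (hr : r ^ 2 + 21 * r + 112 = 0) (hr0 : 2 * r + 21 ≠ 0) (hfrob : r ^ p = -r - 21) :
    midCoeff m (21 : K) 112 = 0 := by
  have hchar : CharP K p := charP_of_injective_algebraMap (algebraMap (ZMod p) K).injective p
  have h2 : (2 : K) ≠ 0 := Ring.two_ne_zero (by rw [ringChar.eq K p]; omega)
  have hα0 : r + 11 ≠ 0 := by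
    have : (r + 11) * (-r - 10) = 2 := by linear_combination -hr
    exact left_ne_zero_of_mul (this ▸ h2)
  -- Move the 2-torsion point `r` to the origin, apply the 2-isogeny, then move the root `9r + 77`
  -- of the new quadratic factor to the origin: the original cubic returns, scaled by `(r + 11)²`.
  have key : midCoeff m (21 : K) 112 = ((r + 11) ^ 2) ^ m * midCoeff m (21 : K) 112 := by
    conv_lhs => rw [midCoeff_translate hm hr, midCoeff_two_isogeny hm]
    rw [midCoeff_translate hm (r := 9 * r + 77) (by linear_combination 24 * hr),
      ← midCoeff_scale m (pow_ne_zero 2 hα0)]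
    congr 1
    · linear_combination (-21) * hr
    · linear_combination (-112 * r ^ 2 - 2576 * r - 14540) * hr
  -- Otherwise `(r + 11) ^ (p - 1) = 1`, so Frobenius fixes `r + 11` instead of sending it to its
  -- conjugate `-r - 10`.
  by_contra hH
  have h1 : ((r + 11) ^ 2) ^ m = 1 := mul_right_cancel₀ hH (by rw [one_mul, ← key])
  have h3 : (r + 11) ^ p = r + 11 := by
    conv_lhs => rw [hm]
    rw [pow_succ, pow_mul, h1, one_mul]
  have h4 : (r + 11) ^ p = -r - 10 := by
    rw [add_pow_char, hfrob, ← frobenius_def p (11 : K), map_ofNat]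
    ring
  exact hr0 (by linear_combination h4 - h3)

theorem cubicCharSum_twenty_one (hp2 : p ≠ 2) (h : quadraticChar (ZMod p) (-7) ≠ 1) :
    cubicCharSum (21 : ZMod p) 112 = 0 := by
  have hF : ringChar (ZMod p) ≠ 2 := by rwa [ZMod.ringChar_zmod_n]
  obtain ⟨m, hm⟩ := hp.out.odd_of_ne_two hp2
  -- When `-7 = 0` the cubic is just `x³`.
  rcases eq_or_ne (-7 : ZMod p) 0 with h0 | h0
  · rw [← quadraticChar_sum_zero hF, cubicCharSum]
    refine Finset.sum_congr rfl fun x _ => ?_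
    have h1 : x ^ 3 + 21 * x ^ 2 + 112 * x = x ^ 3 := by
      linear_combination (-3 * x ^ 2 - 16 * x) * h0
    rcases eq_or_ne x 0 with rfl | hx
    · simp
    · rw [h1, pow_succ, quadraticChar_mul_sq hx]
  have h := (quadraticChar_eq_neg_one_iff_not_one h0).mpr h
  obtain ⟨δ, hδ⟩ := IsAlgClosed.exists_pow_nat_eq (-7 : AlgebraicClosure (ZMod p)) two_pos
  have hpow : (-7 : ZMod p) ^ m = -1 := by
    have := quadraticChar_eq_pow_of_char_ne_two' hF (-7)
    rw [h, ZMod.card, show p / 2 = m by omega] at this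
    simpa using this.symm
  have hmap := congrArg (algebraMap (ZMod p) (AlgebraicClosure (ZMod p))) hpow
  rw [map_pow, map_neg, map_neg, map_one, map_ofNat] at hmap
  have hδ0 : δ ≠ 0 := by
    rintro rfl
    apply h0
    apply (algebraMap (ZMod p) (AlgebraicClosure (ZMod p))).injective
    rw [map_neg, map_ofNat, map_zero, ← hδ, zero_pow two_ne_zero]
  have hδp : δ ^ p = -δ := by
    have : δ ^ (2 * m + 1) = -δ := by rw [pow_succ, pow_mul, hδ, hmap, neg_one_mul]
    rwa [← hm] at this
  have h2 : (2 : AlgebraicClosure (ZMod p)) ≠ 0 :=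
    Ring.two_ne_zero (by rwa [ringChar.eq (AlgebraicClosure (ZMod p)) p])
  -- The discriminant `21² - 4 * 112` is `-7`.
  obtain ⟨r, rfl⟩ : ∃ r, δ = 2 * r + 21 := ⟨(δ - 21) / 2, by field_simp; ring⟩
  have hr : r ^ 2 + 21 * r + 112 = 0 := by
    apply mul_left_cancel₀ (mul_ne_zero h2 h2)
    linear_combination hδ
  have hfrob : r ^ p = -r - 21 := by
    rw [← frobenius_def, map_add, map_mul, map_ofNat, map_ofNat, frobenius_def] at hδp
    apply mul_left_cancel₀ h2
    linear_combination hδp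
  have hH : midCoeff m (21 : ZMod p) 112 = 0 := by
    apply (algebraMap (ZMod p) (AlgebraicClosure (ZMod p))).injective
    rw [map_midCoeff, map_ofNat, map_ofNat, map_zero]
    exact midCoeff_twenty_one_eq_zero hm hr hδ0 hfrob
  have hS : (cubicCharSum (21 : ZMod p) 112 : ZMod p) = 0 := by
    rw [cubicCharSum_cast hm, hH, neg_zero]
  refine Int.eq_zero_of_abs_lt_dvd ((ZMod.intCast_zmod_eq_zero_iff_dvd _ p).mp hS) ?_
  simpa [ZMod.card] using abs_cubicCharSum_lt (21 : ZMod p) 112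

end Hasse

/-! ### From prime fields to squarefree moduli. -/

theorem sum_quadraticChar_eq_zero_of_cubicCharSum {F : Type*} [Field F] [Fintype F]
    [DecidableEq F] (hF : ringChar F ≠ 2) {c d : F} (h : cubicCharSum c d = 0) (i : F) :
    ∑ x : F, quadraticChar F (x * (i ^ 2 + c * i * x + d * x ^ 2)) = 0 := by
  rcases eq_or_ne i 0 with rfl | hi
  · calc ∑ x : F, quadraticChar F (x * (0 ^ 2 + c * 0 * x + d * x ^ 2))
        = ∑ x : F, quadraticChar F d * quadraticChar F x := by
          refine Finset.sum_congr rfl fun x _ => ?_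
          rcases eq_or_ne x 0 with rfl | hx
          · simp
          · rw [← map_mul, ← quadraticChar_mul_sq hx (d * x)]
            congr 1
            ring
      _ = 0 := by rw [← Finset.mul_sum, quadraticChar_sum_zero hF, mul_zero]
  · calc ∑ x : F, quadraticChar F (x * (i ^ 2 + c * i * x + d * x ^ 2))
        = ∑ t : F, quadraticChar F i * quadraticChar F (t ^ 3 + c * t ^ 2 + d * t) := by
          symm
          -- Substitute `x = i / t` and clear denominators by `t⁴`; since `0⁻¹ = 0`, this is a
          -- bijection of all of `F`.
          refine Fintype.sum_bijective (fun t : F => i * t⁻¹)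
            ((mulLeft_bijective₀ i hi).comp inv_bijective) _ _ fun t => ?_
          rcases eq_or_ne t 0 with rfl | ht
          · simp
          · rw [← map_mul, ← quadraticChar_mul_sq hi, ← quadraticChar_mul_sq (pow_ne_zero 2 ht)
              (i * t⁻¹ * _)]
            congr 1
            field_simp
      _ = 0 := by rw [← Finset.mul_sum, ← cubicCharSum, h, mul_zero]

theorem sum_range_natCast_zmod {M : Type*} [AddCommMonoid M] (n : ℕ) [NeZero n] (f : ZMod n → M) :
    ∑ k ∈ Finset.range n, f k = ∑ x : ZMod n, f x :=
  Finset.sum_nbij' (fun k => (k : ZMod n)) ZMod.val (by simp)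
    (fun x _ => Finset.mem_range.mpr x.val_lt)
    (fun k hk => ZMod.val_cast_of_lt (Finset.mem_range.mp hk)) (by simp) (by simp)

theorem sum_range_mul_eq_zero {R : Type*} [CommSemiring R] {m n : ℕ} [NeZero n]
    (hmn : m.Coprime n) {f : ZMod n → R} (hf : ∑ x, f x = 0) {g : ℕ → R}
    (hg : ∀ j k, g (j + m * k) = g j) :
    ∑ j ∈ Finset.range (m * n), g j * f j = 0 := by
  have hsplit : ∀ (N : ℕ) (G : ℕ → R), ∑ j ∈ Finset.range (m * N), G j =
      ∑ k ∈ Finset.range N, ∑ r ∈ Finset.range m, G (r + m * k) := by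
    intro N G
    induction N with
    | zero => simp
    | succ N ih =>
      rw [Finset.sum_range_succ, ← ih, mul_add, mul_one, Finset.sum_range_add]
      simp_rw [add_comm]
  rw [hsplit, Finset.sum_comm]
  refine Finset.sum_eq_zero fun r _ => ?_
  simp_rw [hg, ← Finset.mul_sum]
  rw [← mul_zero (g r), ← hf]
  congr 1
  simp only [Nat.cast_add, Nat.cast_mul]
  rw [sum_range_natCast_zmod n fun x => f (r + m * x)]
  have hu : IsUnit (m : ZMod n) := (ZMod.isUnit_iff_coprime m n).mpr hmn
  exact Fintype.sum_bijective _ ((AddGroup.addLeft_bijective (r : ZMod n)).comp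
    (IsUnit.isUnit_iff_mulLeft_bijective.mp hu)) _ _ fun _ => rfl

/-- The symbol mod the cofactor `m` depends only on `j` mod `m`; within each such class `j` runs
over all residues mod `p`. -/
theorem sum_jacobiSym_eq_zero_of_cubicCharSum {n p : ℕ} [hp : Fact p.Prime] (hp2 : p ≠ 2)
    (hsq : Squarefree n) (hpn : p ∣ n) {c d : ℤ}
    (h : cubicCharSum (c : ZMod p) (d : ZMod p) = 0) (i : ℤ) :
    ∑ j ∈ Finset.range n,
      jacobiSym (j : ℤ) n * jacobiSym (i ^ 2 + c * i * (j : ℤ) + d * (j : ℤ) ^ 2) n = 0 := by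
  obtain ⟨m, rfl⟩ := hpn
  have hcop : m.Coprime p := (Nat.coprime_of_squarefree_mul hsq).symm
  have : NeZero m := ⟨by rintro rfl; simp at hsq⟩
  rw [mul_comm p m]
  have hF : ringChar (ZMod p) ≠ 2 := by rwa [ZMod.ringChar_zmod_n]
  set Q : ℤ → ℤ := fun j => j * (i ^ 2 + c * i * j + d * j ^ 2) with hQ
  rw [← sum_range_mul_eq_zero hcop (sum_quadraticChar_eq_zero_of_cubicCharSum hF h i)
    (g := fun j => jacobiSym (Q j) m)]
  · refine Finset.sum_congr rfl fun j _ => ?_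
    rw [← jacobiSym.mul_left, jacobiSym.mul_right, ← jacobiSym.legendreSym.to_jacobiSym p,
      legendreSym]
    simp only [hQ]
    push_cast
    rfl
  · intro j k
    apply jacobiSym.mod_left'
    have : ((j + m * k : ℕ) : ℤ) ≡ j [ZMOD m] := by
      rw [Int.modEq_comm, Int.modEq_iff_dvd]
      push_cast
      exact ⟨k, by ring⟩
    exact this.mul (((Int.ModEq.refl _).add (this.mul_left _)).add ((this.pow 2).mul_left _))

theorem IsQuadraticResidue.mul {a : ℤ} {m n : ℕ} (hmn : m.Coprime n)
    (hm : IsQuadraticResidue a m) (hn : IsQuadraticResidue a n) :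
    IsQuadraticResidue a (m * n) := by
  obtain ⟨hm, x, hx⟩ := hm
  obtain ⟨hn, y, hy⟩ := hn
  have hc : IsCoprime (m : ℤ) n := Nat.isCoprime_iff_coprime.mpr hmn
  refine ⟨by push_cast; exact hm.mul_right hn, ?_⟩
  obtain ⟨u, v, huv⟩ := id hc
  refine ⟨y * (u * m) + x * (v * n), ?_⟩
  rw [Int.modEq_iff_dvd] at hx hy ⊢
  push_cast
  refine hc.mul_dvd ?_ ?_
  · obtain ⟨k, hk⟩ := hx
    have e : y * (u * m) + x * (v * n) = x + m * (u * (y - x)) := by linear_combination x * huv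
    rw [e]
    exact ⟨k - u * (y - x) * (2 * x + m * (u * (y - x))), by linear_combination hk⟩
  · obtain ⟨k, hk⟩ := hy
    have e : y * (u * m) + x * (v * n) = y + n * (v * (x - y)) := by linear_combination y * huv
    rw [e]
    exact ⟨k - v * (x - y) * (2 * y + n * (v * (x - y))), by linear_combination hk⟩

theorem isQuadraticResidue_of_quadraticChar_eq_one {a : ℤ} {p : ℕ} [Fact p.Prime]
    (h : quadraticChar (ZMod p) a = 1) : IsQuadraticResidue a p := by
  have ha : (a : ZMod p) ≠ 0 := by
    intro h0
    simp [h0] at h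
  constructor
  · rwa [isCoprime_comm, ← ZMod.coe_int_isUnit_iff_isCoprime, isUnit_iff_ne_zero]
  · obtain ⟨y, hy⟩ := (quadraticChar_one_iff_isSquare ha).mp h
    obtain ⟨x, rfl⟩ := ZMod.intCast_surjective y
    refine ⟨x, (ZMod.intCast_eq_intCast_iff _ _ p).mp ?_⟩
    rw [hy]
    push_cast
    ring

/-- Square roots modulo the distinct primes glue by the Chinese remainder theorem. -/
theorem exists_prime_quadraticChar_ne_one {a : ℤ} {n : ℕ} (hsq : Squarefree n)
    (h : ¬ IsQuadraticResidue a n) :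
    ∃ p : ℕ, ∃ _ : Fact p.Prime, p ∣ n ∧ quadraticChar (ZMod p) a ≠ 1 := by
  contrapose! h
  induction n using induction_on_primes with
  | zero => simp at hsq
  | one => exact ⟨by simpa using isCoprime_one_right, 0, by simpa using Int.modEq_one⟩
  | prime_mul p n hp ih =>
    have : Fact p.Prime := ⟨hp⟩
    exact (isQuadraticResidue_of_quadraticChar_eq_one (h p this (dvd_mul_right _ _))).mul
      (Nat.coprime_of_squarefree_mul hsq)
      (ih (hsq.squarefree_of_dvd (dvd_mul_left _ _)) fun q hq hqn =>
        h q hq (hqn.mul_left p))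

theorem sum_jacobiSym_eq_zero_of_not_isQuadraticResidue {n : ℕ} (hodd : Odd n)
    (hsq : Squarefree n) {a c d : ℤ}
    (hcd : ∀ (p : ℕ) [Fact p.Prime], p ≠ 2 → quadraticChar (ZMod p) a ≠ 1 →
      cubicCharSum (c : ZMod p) (d : ZMod p) = 0)
    (h : ¬ IsQuadraticResidue a n) (i : ℤ) :
    ∑ j ∈ Finset.range n,
      jacobiSym (j : ℤ) n * jacobiSym (i ^ 2 + c * i * (j : ℤ) + d * (j : ℤ) ^ 2) n = 0 := by
  obtain ⟨p, hp, hpn, hχ⟩ := exists_prime_quadraticChar_ne_one hsq h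
  have hp2 : p ≠ 2 := by
    rintro rfl
    exact hodd.not_two_dvd_nat hpn
  exact sum_jacobiSym_eq_zero_of_cubicCharSum hp2 hsq hpn (hcd p hp2 hχ) i

theorem theorem1p3 (n : ℕ) (hodd : Odd n) (hsq : Squarefree n) (i : ℤ) :
    (¬ IsQuadraticResidue (-1) n →
      ∑ j ∈ Finset.range n,
        jacobiSym (j : ℤ) n * jacobiSym (i ^ 2 + 3 * i * (j : ℤ) + 2 * (j : ℤ) ^ 2) n = 0) ∧
    (¬ IsQuadraticResidue (-2) n →
      ∑ j ∈ Finset.range n,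
        jacobiSym (j : ℤ) n * jacobiSym (i ^ 2 + 4 * i * (j : ℤ) + 2 * (j : ℤ) ^ 2) n = 0) ∧
    (¬ IsQuadraticResidue (-3) n →
      ∑ j ∈ Finset.range n,
        jacobiSym (j : ℤ) n * jacobiSym (i ^ 2 + 3 * i * (j : ℤ) + 3 * (j : ℤ) ^ 2) n = 0) ∧
    (¬ IsQuadraticResidue (-7) n →
      ∑ j ∈ Finset.range n,
        jacobiSym (j : ℤ) n * jacobiSym (i ^ 2 + 21 * i * (j : ℤ) + 112 * (j : ℤ) ^ 2) n = 0) := by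
  have hF : ∀ (p : ℕ) [Fact p.Prime], p ≠ 2 → ringChar (ZMod p) ≠ 2 := fun p _ hp => by
    rwa [ZMod.ringChar_zmod_n]
  refine ⟨fun h => ?_, fun h => ?_, fun h => ?_, fun h => ?_⟩ <;>
    refine sum_jacobiSym_eq_zero_of_not_isQuadraticResidue hodd hsq (fun p _ hp hχ => ?_) h i <;>
    push_cast at hχ ⊢
  · exact cubicCharSum_three_two
      ((quadraticChar_eq_neg_one_iff_not_one (neg_ne_zero.mpr one_ne_zero)).mpr hχ)
  · exact cubicCharSum_four_two (hF p hp) ((quadraticChar_eq_neg_one_iff_not_one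
      (neg_ne_zero.mpr (Ring.two_ne_zero (hF p hp)))).mpr hχ)
  · exact cubicCharSum_three_three (hF p hp) hχ
  · exact cubicCharSum_twenty_one hp hχ
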